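/- Let $d_1,\dots,d_s$ be positive integers with sum $m$, let $N_{d}\in\mathbb R^{d\times d}$ denote the nilpotent Jordan block (ones on the first superdiagonal, zeros elsewhere), and let $M := \operatorname{diag}(N_{d_1},\dots,N_{d_s})\in\mathbb R^{m\times m}$. Let $\widehat\lambda\in\mathbb C$, let $R\in\mathbb R^{m\times m}$ be entrywise nonnegative, and let $Q\in\mathbb C^{m\times m}$ satisfy $|Q_{ij}|\le R_{ij}$ for all $i,j$. For $p\in\{1,\infty\}$ let $\|\cdot\|_p$ be the matrix norm induced by the $\ell^p$ vector norm, and suppose that $$\operatorname{Re}(\widehat\lambda)-\|M+R\|_p>0\qquad\text{for } p=1 \text{ and for } p=\infty .$$ For $\alpha>0$ put $$\omega(\alpha):=\frac{2\alpha+1}{\alpha^2(\alpha+1)^2}+\frac{\cosh(1)-1}{(\alpha+2)^2},$$ and for $p\in\{1,\infty\}$ put $$\delta_p:=\|R\|_p\Bigl(\Gamma'\bigl(\operatorname{Re}(\widehat\lambda)+\|M+R\|_p\bigr)+\omega\bigl(\operatorname{Re}(\widehat\lambda)+\|M+R\|_p\bigr)+\omega\bigl(\operatorname{Re}(\widehat\lambda)-\|M+R\|_p\bigr)\Bigr),$$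 where $\Gamma'$ is the derivative of the scalar gamma function. Let $\delta:=\min(\delta_1,\delta_\infty)$. Then neither $\widehat\lambda I+M$ nor $\widehat\lambda I+M+Q$ has an eigenvalue in $\{0,-1,-2,\dots\}$, so that the matrix gamma function (the primary matrix function of the scalar $\Gamma$) is defined at both, and $\Gamma(\widehat\lambda I+M+Q)$ lies in the interval matrix with midpoint $\Gamma(\widehat\lambda I+M)$ and radius $\delta$ times the all-ones matrix, that is, $$\bigl|\Gamma(\widehat\lambda I+M+Q)_{ij}-\Gamma(\widehat\lambda I+M)_{ij}\bigr|\le\delta\qquad\text{for all } i,j .$$ -/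

import Mathlib

/-- The polynomial `p` interpolates `f` (in the sense of Hermite) on the spectrum of the square
matrix `A`: at every eigenvalue `z` of `A`, the derivatives of `p` and `f` agree up to (excluding)
the multiplicity of `z` in the minimal polynomial of `A`, which is the size of the largest Jordan
block of `A` at `z`. (If `z` is not an eigenvalue, that multiplicity is `0`.) -/
def InterpolatesOnSpectrum {ι : Type*} [Fintype ι] [DecidableEq ι]
    (f : ℂ → ℂ) (A : Matrix ι ι ℂ) (p : Polynomial ℂ) : Prop :=
  ∀ z : ℂ, ∀ k < (minpoly ℂ A).rootMultiplicity z,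
    (Polynomial.derivative^[k] p).eval z = iteratedDeriv k f z

/-- There is a polynomial with prescribed derivatives of order less than `N` at a point. -/
theorem exists_polynomial_derivatives (z : ℂ) (N : ℕ) (c : ℕ → ℂ) :
    ∃ p : Polynomial ℂ, ∀ k < N, (Polynomial.derivative^[k] p).eval z = c k := by
  refine ⟨Polynomial.taylor (-z) (∑ i ∈ Finset.range N,
    Polynomial.monomial i (c i / (i.factorial : ℂ))), fun k hk => ?_⟩
  rw [← Polynomial.factorial_smul_hasseDeriv]
  have hfac : (k.factorial : ℂ) ≠ 0 := by exact_mod_cast k.factorial_ne_zero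
  simp only [LinearMap.smul_apply, Polynomial.eval_smul]
  rw [← Polynomial.taylor_coeff, Polynomial.taylor_taylor]
  simp only [add_neg_cancel, Polynomial.taylor_zero, Polynomial.finsetSum_coeff,
    Polynomial.coeff_monomial]
  rw [Finset.sum_ite_eq' (Finset.range N) k, if_pos (Finset.mem_range.2 hk), nsmul_eq_mul]
  field_simp

/-- If `p - q` is divisible by `(X - z) ^ N`, then `p` and `q` have the same derivatives of
order less than `N` at `z`. -/
theorem derivative_eval_eq_of_dvd {p q : Polynomial ℂ} {z : ℂ} {N : ℕ}
    (h : (Polynomial.X - Polynomial.C z) ^ N ∣ p - q) {k : ℕ} (hk : k < N) :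
    (Polynomial.derivative^[k] p).eval z = (Polynomial.derivative^[k] q).eval z := by
  by_cases h0 : p - q = 0
  · rw [sub_eq_zero.1 h0]
  · have h1 : k < (p - q).rootMultiplicity z :=
      lt_of_lt_of_le hk ((Polynomial.le_rootMultiplicity_iff h0).2 h)
    have h2 := (Polynomial.lt_rootMultiplicity_iff_isRoot_iterate_derivative h0).1 h1 k le_rfl
    rw [Polynomial.IsRoot, Polynomial.iterate_derivative_sub, Polynomial.eval_sub] at h2
    exact sub_eq_zero.1 h2

/-- A Hermite interpolant always exists. -/
theorem exists_interpolatesOnSpectrum {ι : Type*} [Fintype ι] [DecidableEq ι]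
    (f : ℂ → ℂ) (A : Matrix ι ι ℂ) : ∃ p, InterpolatesOnSpectrum f A p := by
  set m := minpoly ℂ A
  have hm : m ≠ 0 := minpoly.ne_zero (Matrix.isIntegral A)
  choose T hT using fun z : ℂ =>
    exists_polynomial_derivatives z (m.rootMultiplicity z) (fun k => iteratedDeriv k f z)
  let I : m.roots.toFinset → Ideal (Polynomial ℂ) := fun z =>
    Ideal.span {(Polynomial.X - Polynomial.C (z : ℂ)) ^ m.rootMultiplicity (z : ℂ)}
  have hI : Pairwise (Function.onFun IsCoprime I) := by
    intro a b hab
    simp only [Function.onFun, I]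
    rw [Ideal.isCoprime_span_singleton_iff]
    exact (Polynomial.isCoprime_X_sub_C_of_isUnit_sub
      (sub_ne_zero.2 (fun h => hab (Subtype.ext h))).isUnit).pow
  obtain ⟨p, hp⟩ := Ideal.exists_forall_sub_mem_ideal hI (fun z => T z)
  refine ⟨p, fun z k hk => ?_⟩
  have hz : z ∈ m.roots.toFinset := by
    rw [Multiset.mem_toFinset, Polynomial.mem_roots hm]
    exact (Polynomial.rootMultiplicity_pos hm).1 (lt_of_le_of_lt (Nat.zero_le k) hk)
  rw [← hT z k hk]
  exact derivative_eval_eq_of_dvd (Ideal.mem_span_singleton.1 (hp ⟨z, hz⟩)) hk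

/-- The primary matrix function `f(A) := p(A)`, where `p` is any polynomial that interpolates `f`
on the spectrum of `A`; this is the standard definition when `f` has the derivatives in question at
the eigenvalues of `A`. -/
noncomputable def matrixFunction {ι : Type*} [Fintype ι] [DecidableEq ι]
    (f : ℂ → ℂ) (A : Matrix ι ι ℂ) : Matrix ι ι ℂ :=
  Polynomial.aeval A (exists_interpolatesOnSpectrum f A).choose

/-- The value `f(A)` does not depend on the choice of the interpolating polynomial. -/
theorem matrixFunction_eq_aeval {ι : Type*} [Fintype ι] [DecidableEq ι]
    {f : ℂ → ℂ} {A : Matrix ι ι ℂ} {p : Polynomial ℂ} (hp : InterpolatesOnSpectrum f A p) :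
    matrixFunction f A = Polynomial.aeval A p := by
  set q := (exists_interpolatesOnSpectrum f A).choose with hq_def
  have hq : InterpolatesOnSpectrum f A q := (exists_interpolatesOnSpectrum f A).choose_spec
  change Polynomial.aeval A q = Polynomial.aeval A p
  have hm : minpoly ℂ A ≠ 0 := minpoly.ne_zero (Matrix.isIntegral A)
  rw [← sub_eq_zero, ← map_sub]
  by_cases h0 : q - p = 0
  · rw [h0, map_zero]
  · apply (minpoly.dvd_iff).1
    rw [IsAlgClosed.dvd_iff_roots_le_roots hm h0, Multiset.le_iff_count]
    intro z
    rw [Polynomial.count_roots, Polynomial.count_roots]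
    by_contra hlt
    rw [not_le] at hlt
    refine lt_irrefl ((q - p).rootMultiplicity z)
      ((Polynomial.lt_rootMultiplicity_iff_isRoot_iterate_derivative h0).2 fun k hk => ?_)
    rw [Polynomial.IsRoot, Polynomial.iterate_derivative_sub, Polynomial.eval_sub,
      hq z k (lt_of_le_of_lt hk hlt), hp z k (lt_of_le_of_lt hk hlt), sub_self]

/-- The matrix gamma function `Γ(A)`, the primary matrix function that belongs to the scalar gamma
function (meaningful for matrices without eigenvalues in `{0, -1, -2, …}`). -/
noncomputable def matrixGamma {ι : Type*} [Fintype ι] [DecidableEq ι]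
    (A : Matrix ι ι ℂ) : Matrix ι ι ℂ :=
  matrixFunction Complex.Gamma A

/-- `A` has no eigenvalue in `{0, -1, -2, …}`, the condition under which `Γ(A)` is well defined. -/
def GammaDefinedAt {ι : Type*} [Fintype ι] [DecidableEq ι] (A : Matrix ι ι ℂ) : Prop :=
  ∀ k : ℕ, -(k : ℂ) ∉ spectrum ℂ A

/-- The operator norm of a real matrix that is induced by the `ℓ^p` norm of vectors
(`p = 1`: the largest column sum of `|A|`; `p = ⊤`: the largest row sum of `|A|`). -/
noncomputable def inducedNorm {ι : Type*} [Fintype ι] [DecidableEq ι]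
    (p : ENNReal) [Fact (1 ≤ p)] (A : Matrix ι ι ℝ) : ℝ :=
  ‖LinearMap.toContinuousLinearMap (Matrix.toLpLin p p A)‖

/-- The `d × d` nilpotent Jordan block: ones on the first superdiagonal, zeros elsewhere. -/
def nilpotentBlock (d : ℕ) : Matrix (Fin d) (Fin d) ℝ :=
  Matrix.of fun i j => if (i : ℕ) + 1 = (j : ℕ) then 1 else 0

/-- The block diagonal matrix `diag(N_1, …, N_s)` of nilpotent Jordan blocks of sizes
`d 0, …, d (s - 1)`. Its rows and columns are indexed by pairs (number of the block, position in
the block), so that its size is the sum of the `d l`. -/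
def nilpotentJordan {s : ℕ} (d : Fin s → ℕ) :
    Matrix (Σ l : Fin s, Fin (d l)) (Σ l : Fin s, Fin (d l)) ℝ :=
  Matrix.blockDiagonal' fun l => nilpotentBlock (d l)

/-- `ω(α) = (2α + 1) / (α² (α + 1)²) + (cosh 1 - 1) / (α + 2)²`. -/
noncomputable def omegaBound (α : ℝ) : ℝ :=
  (2 * α + 1) / (α ^ 2 * (α + 1) ^ 2) + (Real.cosh 1 - 1) / (α + 2) ^ 2

/-- The perturbation bound `δ_p`; here `deriv Real.Gamma` is the derivative of the scalar gamma
function. -/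
noncomputable def deltaBound {ι : Type*} [Fintype ι] [DecidableEq ι]
    (p : ENNReal) [Fact (1 ≤ p)] (lam : ℂ) (M R : Matrix ι ι ℝ) : ℝ :=
  inducedNorm p R *
    (deriv Real.Gamma (lam.re + inducedNorm p (M + R))
      + omegaBound (lam.re + inducedNorm p (M + R))
      + omegaBound (lam.re - inducedNorm p (M + R)))

/-- The complex interval matrix with midpoint `C` and radius `R`: all complex matrices `X` with
`|X - C| ≤ R` entrywise. -/
def intervalMatrix {ι κ : Type*} (C : Matrix ι κ ℂ) (R : Matrix ι κ ℝ) : Set (Matrix ι κ ℂ) :=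
  {X | ∀ i j, ‖X i j - C i j‖ ≤ R i j}

/-! Where the spectrum lies in the open right half plane, `Γ(A) = ∫₀^∞ (e^{-t}/t) exp(log t · A) dt`
entrywise, so the perturbation of `Γ` reduces to that of `exp`. Write `s = Re λ`, `n = ‖M + R‖_p`,
`L = log t`. The scalar part of the matrices contributes exactly the modulus `t^s`. Telescoping the
powers and summing the exponential series bounds each entry of `exp(L(M + Q)) - exp(LM)` by `‖R‖_p
|L| e^{|L| n}` (`norm_exp_smul_sub_exp_smul_apply_le`).

For `t > 1` the resulting majorant `‖R‖_p e^{-t} |log t| t^{s-1} e^{|log t| n}` is `‖R‖_p` times the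
integrand of `Γ'(s + n)`. On `(0, 1]` that integrand is nonpositive, while the majorant has the
exponent `s - n - 1`. There `e^{-t} ≤ 1 - t + (cosh 1 - 1) t²` (`exp_neg_le_quadratic`) bounds both
pieces by integrals equal to `ω`: `ω(s + n)` makes up for the negative part of `Γ'(s + n)`, and `ω(s
- n)` dominates the true majorant (`exp_neg_div_mul_log_mul_exp_le`). The condition `s - n > 0`
gives convergence at `0` and puts both spectra in the right half plane. Of the Jordan structure only
the nonnegativity of the entries of `M` enters.

Euler's integral for matrices follows from the scalar one because a primary matrix function is a
linear image of the finite jet of the scalar function on the spectrum (`exists_linearMap_jet`). -/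

/-! ### Induced `ℓ^p` norms and entrywise domination -/

section InducedNorm

variable {ι : Type*} [Fintype ι] [DecidableEq ι] (p : ENNReal) [Fact (1 ≤ p)]

omit [DecidableEq ι] in
theorem norm_toLp_le_of_forall_abs_le {u v : ι → ℝ} (h : ∀ i, |u i| ≤ |v i|) :
    ‖WithLp.toLp p u‖ ≤ ‖WithLp.toLp p v‖ := by
  rcases eq_or_ne p ⊤ with rfl | hp
  · rw [PiLp.norm_toLp, PiLp.norm_toLp]
    exact (pi_norm_le_iff_of_nonneg (norm_nonneg _)).2 fun i =>
      (h i).trans (norm_le_pi_norm v i)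
  · have h1 : (1 : ENNReal) ≤ p := Fact.out
    have hp0 : 0 < p.toReal := ENNReal.toReal_pos (by positivity) hp
    rw [PiLp.norm_eq_sum hp0, PiLp.norm_eq_sum hp0]
    have : ∀ i, 0 ≤ ‖u i‖ := fun i => norm_nonneg _
    have h' : ∀ i, ‖u i‖ ≤ ‖v i‖ := h
    refine Real.rpow_le_rpow (Finset.sum_nonneg fun i _ => Real.rpow_nonneg (this i) _)
      (Finset.sum_le_sum fun i _ => Real.rpow_le_rpow (this i) (h' i) hp0.le) (by positivity)

theorem inducedNorm_nonneg (A : Matrix ι ι ℝ) : 0 ≤ inducedNorm p A := norm_nonneg _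

theorem norm_toLp_mulVec_le (A : Matrix ι ι ℝ) (x : ι → ℝ) :
    ‖WithLp.toLp p (A.mulVec x)‖ ≤ inducedNorm p A * ‖WithLp.toLp p x‖ := by
  have := (LinearMap.toContinuousLinearMap (Matrix.toLpLin p p A)).le_opNorm (WithLp.toLp p x)
  simpa [inducedNorm, Matrix.toLpLin_toLp] using this

theorem inducedNorm_le_of_forall {A : Matrix ι ι ℝ} {c : ℝ} (hc : 0 ≤ c)
    (h : ∀ x : ι → ℝ, ‖WithLp.toLp p (A.mulVec x)‖ ≤ c * ‖WithLp.toLp p x‖) :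
    inducedNorm p A ≤ c := by
  refine ContinuousLinearMap.opNorm_le_bound _ hc fun x => ?_
  simpa [Matrix.toLpLin_apply] using h x.ofLp

theorem abs_apply_le_inducedNorm (A : Matrix ι ι ℝ) (i j : ι) : |A i j| ≤ inducedNorm p A := by
  have h := norm_toLp_mulVec_le p A (Pi.single j 1)
  have h1 : ‖WithLp.toLp p (Pi.single j (1 : ℝ) : ι → ℝ)‖ = 1 := by
    simp
  have h2 := PiLp.norm_apply_le (WithLp.toLp p (A.mulVec (Pi.single j 1))) i
  rw [h1, mul_one] at h
  simpa using h2.trans h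

theorem inducedNorm_mul_le (A B : Matrix ι ι ℝ) :
    inducedNorm p (A * B) ≤ inducedNorm p A * inducedNorm p B := by
  refine inducedNorm_le_of_forall p
    (mul_nonneg (inducedNorm_nonneg p A) (inducedNorm_nonneg p B)) fun x => ?_
  rw [← Matrix.mulVec_mulVec, mul_assoc]
  exact (norm_toLp_mulVec_le p A _).trans
    (mul_le_mul_of_nonneg_left (norm_toLp_mulVec_le p B x) (inducedNorm_nonneg p A))

theorem inducedNorm_add_le (A B : Matrix ι ι ℝ) :
    inducedNorm p (A + B) ≤ inducedNorm p A + inducedNorm p B := by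
  simp only [inducedNorm, map_add]
  exact norm_add_le _ _

theorem inducedNorm_pow_le (A : Matrix ι ι ℝ) (n : ℕ) :
    inducedNorm p (A ^ n) ≤ inducedNorm p A ^ n := by
  induction n with
  | zero => exact inducedNorm_le_of_forall p (by simp) fun x => by simp
  | succ n ih =>
    rw [pow_succ, pow_succ]
    exact (inducedNorm_mul_le p _ _).trans
      (mul_le_mul_of_nonneg_right ih (inducedNorm_nonneg p A))

theorem inducedNorm_mono {A B : Matrix ι ι ℝ} (hA : ∀ i j, 0 ≤ A i j)
    (hAB : ∀ i j, A i j ≤ B i j) : inducedNorm p A ≤ inducedNorm p B := by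
  refine inducedNorm_le_of_forall p (inducedNorm_nonneg p B) fun x => ?_
  have hx : ‖WithLp.toLp p (fun i => |x i|)‖ ≤ ‖WithLp.toLp p x‖ :=
    norm_toLp_le_of_forall_abs_le p fun i => by simp
  refine le_trans (norm_toLp_le_of_forall_abs_le p fun i => ?_)
    ((norm_toLp_mulVec_le p B fun i => |x i|).trans
      (mul_le_mul_of_nonneg_left hx (inducedNorm_nonneg p B)))
  refine le_trans ?_ (le_abs_self _)
  refine (Finset.abs_sum_le_sum_abs _ _).trans (Finset.sum_le_sum fun j _ => ?_)
  rw [abs_mul, abs_of_nonneg (hA i j)]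
  exact mul_le_mul_of_nonneg_right (hAB i j) (abs_nonneg _)

/-- The spectral radius of a complex matrix is at most the induced norm of an entrywise
majorant. -/
theorem norm_le_inducedNorm_of_mem_spectrum {X : Matrix ι ι ℂ} {B : Matrix ι ι ℝ}
    (h : ∀ i j, ‖X i j‖ ≤ B i j) {z : ℂ} (hz : z ∈ spectrum ℂ X) : ‖z‖ ≤ inducedNorm p B := by
  rw [← Matrix.spectrum_toLin', ← Module.End.hasEigenvalue_iff_mem_spectrum] at hz
  obtain ⟨v, hv⟩ := hz.exists_hasEigenvector
  have hXv : X.mulVec v = z • v := by simpa using hv.apply_eq_smul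
  -- Pass to the vector of moduli: `|z| |v| = |X v| ≤ B |v|` entrywise, and the `ℓ^p` norm is
  -- monotone in the moduli of the entries.
  have hv0 : 0 < ‖WithLp.toLp p (fun i => ‖v i‖)‖ := by
    rw [norm_pos_iff]
    intro h0
    apply hv.2
    funext i
    have := congrArg (fun w : WithLp p (ι → ℝ) => w i) h0
    simpa using this
  refine le_of_mul_le_mul_right ?_ hv0
  refine le_trans ?_ (norm_toLp_mulVec_le p B fun i => ‖v i‖)
  rw [← norm_norm z, ← norm_smul, ← WithLp.toLp_smul]
  refine norm_toLp_le_of_forall_abs_le p fun i => ?_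
  refine le_trans ?_ (le_abs_self _)
  have h1 : ‖z‖ * ‖v i‖ = ‖(X.mulVec v) i‖ := by rw [hXv]; simp
  simp only [Pi.smul_apply, smul_eq_mul, abs_mul, abs_norm]
  rw [h1]
  refine (norm_sum_le _ _).trans (Finset.sum_le_sum fun j _ => ?_)
  rw [norm_mul]
  exact mul_le_mul_of_nonneg_right (h i j) (norm_nonneg _)

/-- Telescoping: each of the `n` terms has one factor `B - M` and `n - 1` factors `B` or `M`, and `0
≤ M ≤ B` makes `‖M‖ ≤ ‖B‖`. -/
theorem inducedNorm_pow_sub_pow_le {M B : Matrix ι ι ℝ} (hM : ∀ i j, 0 ≤ M i j)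
    (hMB : ∀ i j, M i j ≤ B i j) (n : ℕ) :
    inducedNorm p (B ^ n - M ^ n) ≤ n * inducedNorm p B ^ (n - 1) * inducedNorm p (B - M) := by
  have hB := inducedNorm_nonneg p B
  have hBM := inducedNorm_nonneg p (B - M)
  induction n with
  | zero => simp [inducedNorm]
  | succ n ih =>
    have h1 : B ^ (n + 1) - M ^ (n + 1) = B ^ n * (B - M) + (B ^ n - M ^ n) * M := by
      rw [pow_succ, pow_succ]; noncomm_ring
    rw [h1]
    refine (inducedNorm_add_le p _ _).trans ?_
    have h2 : inducedNorm p (B ^ n * (B - M)) ≤ inducedNorm p B ^ n * inducedNorm p (B - M) :=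
      (inducedNorm_mul_le p _ _).trans
        (mul_le_mul_of_nonneg_right (inducedNorm_pow_le p B n) hBM)
    have h3 : inducedNorm p ((B ^ n - M ^ n) * M) ≤
        n * inducedNorm p B ^ (n - 1) * inducedNorm p (B - M) * inducedNorm p B :=
      (inducedNorm_mul_le p _ _).trans
        (mul_le_mul ih (inducedNorm_mono p hM hMB) (inducedNorm_nonneg p M) (by positivity))
    -- For `n = 0` the truncated exponent `n - 1` is harmless, since the factor `n` vanishes.
    have h4 : (n : ℝ) * inducedNorm p B ^ (n - 1) * inducedNorm p B = n * inducedNorm p B ^ n := by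
      rcases n with _ | n
      · simp
      · rw [Nat.add_sub_cancel, mul_assoc, ← pow_succ]
    calc _ ≤ inducedNorm p B ^ n * inducedNorm p (B - M)
          + n * inducedNorm p B ^ (n - 1) * inducedNorm p (B - M) * inducedNorm p B :=
          add_le_add h2 h3
      _ = inducedNorm p B ^ n * inducedNorm p (B - M)
          + (n * inducedNorm p B ^ (n - 1) * inducedNorm p B) * inducedNorm p (B - M) := by ring
      _ = _ := by rw [h4, Nat.add_sub_cancel]; push_cast; ring

end InducedNorm

/-! ### Entrywise majorants for powers of a perturbed matrix -/

section EntrywiseBounds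

variable {ι : Type*} [Fintype ι] [DecidableEq ι] {M R : Matrix ι ι ℝ} {Q : Matrix ι ι ℂ}

omit [Fintype ι] [DecidableEq ι] in
theorem norm_ofReal_map_add_apply_le (hM : ∀ i j, 0 ≤ M i j) (hQ : ∀ i j, ‖Q i j‖ ≤ R i j)
    (i j : ι) : ‖(M.map Complex.ofReal + Q) i j‖ ≤ (M + R) i j := by
  rw [Matrix.add_apply, Matrix.add_apply]
  refine (norm_add_le _ _).trans (add_le_add (le_of_eq ?_) (hQ i j))
  simp [abs_of_nonneg (hM i j)]

theorem norm_pow_apply_le {X : Matrix ι ι ℂ} {B : Matrix ι ι ℝ} (h : ∀ i j, ‖X i j‖ ≤ B i j)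
    (n : ℕ) (i j : ι) : ‖(X ^ n) i j‖ ≤ (B ^ n) i j := by
  induction n generalizing i j with
  | zero => simp only [pow_zero, Matrix.one_apply]; split_ifs <;> simp
  | succ n ih =>
    rw [pow_succ, pow_succ, Matrix.mul_apply, Matrix.mul_apply]
    refine (norm_sum_le _ _).trans (Finset.sum_le_sum fun k _ => ?_)
    rw [norm_mul]
    exact mul_le_mul (ih i k) (h k j) (norm_nonneg _) ((norm_nonneg _).trans (ih i k))

/-- The complex and the real difference telescope in the same way, so the triangle inequality
compares them term by term. This trades the complex `Q` for the nonnegative `R`. -/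
theorem norm_pow_sub_pow_apply_le (hM : ∀ i j, 0 ≤ M i j) (hQ : ∀ i j, ‖Q i j‖ ≤ R i j)
    (n : ℕ) (i j : ι) :
    ‖((M.map Complex.ofReal + Q) ^ n - M.map Complex.ofReal ^ n) i j‖ ≤
      ((M + R) ^ n - M ^ n) i j := by
  induction n generalizing i j with
  | zero => simp
  | succ n ih =>
    set X := M.map Complex.ofReal + Q with hX
    have h1 : X ^ (n + 1) - M.map Complex.ofReal ^ (n + 1) =
        X ^ n * Q + (X ^ n - M.map Complex.ofReal ^ n) * M.map Complex.ofReal := by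
      rw [pow_succ, pow_succ, sub_mul]
      nth_rewrite 2 [hX]
      noncomm_ring
    have h2 : (M + R) ^ (n + 1) - M ^ (n + 1) = (M + R) ^ n * R + ((M + R) ^ n - M ^ n) * M := by
      rw [pow_succ, pow_succ]; noncomm_ring
    have hXn := norm_pow_apply_le (norm_ofReal_map_add_apply_le hM hQ) n
    rw [h1, h2, Matrix.add_apply, Matrix.add_apply, Matrix.mul_apply, Matrix.mul_apply,
      Matrix.mul_apply, Matrix.mul_apply]
    refine (norm_add_le _ _).trans (add_le_add ?_ ?_)
    · refine (norm_sum_le _ _).trans (Finset.sum_le_sum fun k _ => ?_)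
      rw [norm_mul]
      exact mul_le_mul (hXn i k) (hQ k j) (norm_nonneg _) ((norm_nonneg _).trans (hXn i k))
    · refine (norm_sum_le _ _).trans (Finset.sum_le_sum fun k _ => ?_)
      rw [norm_mul]
      refine mul_le_mul (ih i k) (le_of_eq ?_) (norm_nonneg _) ((norm_nonneg _).trans (ih i k))
      simp [abs_of_nonneg (hM k j)]

end EntrywiseBounds

/-! ### Perturbation of the matrix exponential -/

section MatrixExp

open scoped Matrix.Norms.Operator

variable {ι : Type*} [Fintype ι] [DecidableEq ι]

theorem hasSum_matrix_exp_smul (L : ℂ) (A : Matrix ι ι ℂ) :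
    HasSum (fun n : ℕ => (L ^ n / n.factorial) • A ^ n) (NormedSpace.exp (L • A)) := by
  have := NormedSpace.exp_series_hasSum_exp' (𝕂 := ℂ) (L • A)
  refine (congrArg (HasSum · _) (funext fun n => ?_)).mp this
  rw [smul_pow, smul_smul, div_eq_inv_mul]

/-- The exponential series is compared termwise with `∑ |L|^n / n! · n ν^(n-1) ‖R‖`, which is `‖R‖`
times the derivative of `e^{|L| ν}` in `ν`. -/
theorem norm_exp_smul_sub_exp_smul_apply_le (p : ENNReal) [Fact (1 ≤ p)] {M R : Matrix ι ι ℝ}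
    {Q : Matrix ι ι ℂ} (hM : ∀ i j, 0 ≤ M i j) (hQ : ∀ i j, ‖Q i j‖ ≤ R i j) (L : ℝ) (i j : ι) :
    ‖NormedSpace.exp ((L : ℂ) • (M.map Complex.ofReal + Q)) i j
        - NormedSpace.exp ((L : ℂ) • M.map Complex.ofReal) i j‖ ≤
      inducedNorm p R * (|L| * Real.exp (|L| * inducedNorm p (M + R))) := by
  set ν := inducedNorm p (M + R)
  have hR : ∀ i j, 0 ≤ R i j := fun i j => (norm_nonneg _).trans (hQ i j)
  have hs := (hasSum_matrix_exp_smul L (M.map Complex.ofReal + Q)).sub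
    (hasSum_matrix_exp_smul L (M.map Complex.ofReal))
  have hs' := (Pi.hasSum.1 ((Pi.hasSum.1 hs) i)) j
  have hexp : HasSum (fun n : ℕ => (|L| * ν) ^ n / n.factorial) (Real.exp (|L| * ν)) := by
    rw [Real.exp_eq_exp_ℝ]
    exact NormedSpace.expSeries_div_hasSum_exp (|L| * ν)
  have hmaj : HasSum (fun n : ℕ => |L| ^ n / n.factorial * (n * ν ^ (n - 1) * inducedNorm p R))
      (inducedNorm p R * (|L| * Real.exp (|L| * ν))) := by
    -- The term of index `0` is zero; after the shift `n + 1` cancels against `(n + 1)!`.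
    rw [← hasSum_nat_add_iff' 1]
    simp only [Finset.range_one, Finset.sum_singleton, CharP.cast_eq_zero, zero_mul, mul_zero,
      sub_zero]
    refine (congrArg (HasSum · _) (funext fun n => ?_)).mp ((hexp.mul_left |L|).mul_left (inducedNorm p R))
    rw [Nat.factorial_succ, Nat.add_sub_cancel]
    push_cast
    field_simp
    ring
  refine hs'.norm_le_of_bounded hmaj fun n => ?_
  have h1 : ‖((M.map Complex.ofReal + Q) ^ n - M.map Complex.ofReal ^ n) i j‖ ≤
      n * ν ^ (n - 1) * inducedNorm p R := by
    refine (norm_pow_sub_pow_apply_le hM hQ n i j).trans ((le_abs_self _).trans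
      ((abs_apply_le_inducedNorm p _ i j).trans ?_))
    have := inducedNorm_pow_sub_pow_le p (B := M + R) hM
      (fun i j => le_add_of_nonneg_right (hR i j)) n
    rwa [add_sub_cancel_left] at this
  have h2 : ((L : ℂ) ^ n / n.factorial) • (M.map Complex.ofReal + Q) ^ n
      - ((L : ℂ) ^ n / n.factorial) • M.map Complex.ofReal ^ n =
      ((L : ℂ) ^ n / n.factorial) • ((M.map Complex.ofReal + Q) ^ n - M.map Complex.ofReal ^ n) :=
    (smul_sub _ _ _).symm
  rw [h2, Matrix.smul_apply, norm_smul]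
  refine mul_le_mul (le_of_eq ?_) h1 (norm_nonneg _) (by positivity)
  simp

end MatrixExp

/-! ### Matrix functions as linear functions of jets -/

section Jets

variable {ι : Type*} [Fintype ι] [DecidableEq ι]

/-- The pairs of an eigenvalue of `A` and an order less than its multiplicity in the minimal
polynomial. -/
abbrev JetIndex (A : Matrix ι ι ℂ) : Type :=
  Σ z : (minpoly ℂ A).roots.toFinset, Fin ((minpoly ℂ A).rootMultiplicity (z : ℂ))

theorem JetIndex.mem_spectrum {A : Matrix ι ι ℂ} (x : JetIndex A) : (x.1 : ℂ) ∈ spectrum ℂ A := by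
  have h := x.1.2
  rw [Multiset.mem_toFinset, Polynomial.mem_roots (minpoly.ne_zero (Matrix.isIntegral A))] at h
  exact Matrix.mem_spectrum_of_isRoot_charpoly (h.dvd (Matrix.minpoly_dvd_charpoly A))

theorem iteratedDeriv_polynomial_eval (p : Polynomial ℂ) (k : ℕ) :
    iteratedDeriv k (fun z => p.eval z) = fun z => (Polynomial.derivative^[k] p).eval z := by
  induction k generalizing p with
  | zero => simp
  | succ k ih =>
    rw [iteratedDeriv_succ', Function.iterate_succ_apply, ← ih]
    congr 1
    funext z
    exact p.deriv

theorem aeval_eq_of_interpolatesOnSpectrum {A : Matrix ι ι ℂ} {f : ℂ → ℂ} {p q : Polynomial ℂ}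
    (hp : InterpolatesOnSpectrum f A p) (hq : InterpolatesOnSpectrum f A q) :
    Polynomial.aeval A p = Polynomial.aeval A q := by
  rw [← matrixFunction_eq_aeval hp, matrixFunction_eq_aeval hq]

/-- A primary matrix function is a linear function of the jet of the scalar function at the
spectrum. -/
theorem exists_linearMap_jet (A : Matrix ι ι ℂ) :
    ∃ G : (JetIndex A → ℂ) →ₗ[ℂ] Matrix ι ι ℂ,
      (∀ p : Polynomial ℂ,
        Polynomial.aeval A p = G fun x => (Polynomial.derivative^[(x.2 : ℕ)] p).eval (x.1 : ℂ)) ∧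
      ∀ f : ℂ → ℂ, matrixFunction f A = G fun x => iteratedDeriv x.2 f x.1 := by
  let Φ : Polynomial ℂ →ₗ[ℂ] (JetIndex A → ℂ) := LinearMap.pi fun x =>
    (Polynomial.leval (x.1 : ℂ)).comp (Polynomial.derivative ^ (x.2 : ℕ))
  have hΦ : ∀ p x, Φ p x = (Polynomial.derivative^[(x.2 : ℕ)] p).eval (x.1 : ℂ) := by
    intro p x
    simp [Φ, Module.End.pow_apply, Polynomial.leval]
  have hjet : ∀ (f : ℂ → ℂ) (p : Polynomial ℂ), (∀ x : JetIndex A,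
      (Polynomial.derivative^[(x.2 : ℕ)] p).eval (x.1 : ℂ) = iteratedDeriv x.2 f x.1) →
      InterpolatesOnSpectrum f A p := by
    intro f p h z k hk
    have hm : minpoly ℂ A ≠ 0 := minpoly.ne_zero (Matrix.isIntegral A)
    have hz : z ∈ (minpoly ℂ A).roots.toFinset := by
      rw [Multiset.mem_toFinset, Polynomial.mem_roots hm]
      exact (Polynomial.rootMultiplicity_pos hm).1 (lt_of_le_of_lt (Nat.zero_le k) hk)
    exact h ⟨⟨z, hz⟩, ⟨k, hk⟩⟩
  have hker : LinearMap.ker Φ ≤ LinearMap.ker (Polynomial.aeval A).toLinearMap := by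
    intro p hp
    rw [LinearMap.mem_ker] at hp ⊢
    have h0 : InterpolatesOnSpectrum (fun z => (0 : Polynomial ℂ).eval z) A p :=
      hjet _ _ fun x => by
        rw [← hΦ, hp, iteratedDeriv_polynomial_eval]
        simp
    have h1 : InterpolatesOnSpectrum (fun z => (0 : Polynomial ℂ).eval z) A 0 :=
      hjet _ _ fun x => by rw [iteratedDeriv_polynomial_eval]
    simpa using aeval_eq_of_interpolatesOnSpectrum h0 h1
  -- By `hker`, `p(A)` depends only on the jet `Φ p`. Composing with a linear section of `Φ` over
  -- its range and extending to all jets gives `G`, without having to know that `Φ` is onto.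
  obtain ⟨s, hs⟩ := Φ.rangeRestrict.exists_rightInverse_of_surjective
    (LinearMap.range_rangeRestrict Φ)
  obtain ⟨G, hG⟩ := LinearMap.exists_extend ((Polynomial.aeval A).toLinearMap.comp s)
  have hGp : ∀ p : Polynomial ℂ, Polynomial.aeval A p =
      G fun x => (Polynomial.derivative^[(x.2 : ℕ)] p).eval (x.1 : ℂ) := by
    intro p
    have h1 : (fun x => (Polynomial.derivative^[(x.2 : ℕ)] p).eval (x.1 : ℂ)) = Φ p :=
      funext fun x => (hΦ p x).symm
    have h2 : G (Φ p) = Polynomial.aeval A (s (Φ.rangeRestrict p)) :=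
      LinearMap.congr_fun hG (Φ.rangeRestrict p)
    have h3 : Φ (s (Φ.rangeRestrict p)) = Φ p :=
      congrArg Subtype.val (LinearMap.congr_fun hs (Φ.rangeRestrict p))
    have h4 : p - s (Φ.rangeRestrict p) ∈ LinearMap.ker Φ := by
      rw [LinearMap.mem_ker, map_sub, h3, sub_self]
    have h5 := hker h4
    rw [LinearMap.mem_ker, map_sub, sub_eq_zero] at h5
    rw [h1, h2]
    exact h5
  refine ⟨G, hGp, fun f => ?_⟩
  obtain ⟨p, hp⟩ := exists_interpolatesOnSpectrum f A
  rw [matrixFunction_eq_aeval hp, hGp]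
  exact congrArg G (funext fun x => hp x.1 x.2 x.2.2)

end Jets

/-! ### Integrals for the derivatives of `Γ` and for `ω` -/

section GammaIntegrals

open MeasureTheory Set Filter Topology Asymptotics

/-- Each factor `log t` costs an arbitrarily small power of `t`, paid in the induction by passing to
`a + 1` at infinity and to `b / 2` at zero. -/
theorem isBigO_log_pow_mul_exp_neg (k : ℕ) (a b : ℝ) (hb : 0 < b) :
    (fun t : ℝ => (((Real.log t) ^ k * Real.exp (-t) : ℝ) : ℂ)) =O[atTop] (· ^ (-a)) ∧
    (fun t : ℝ => (((Real.log t) ^ k * Real.exp (-t) : ℝ) : ℂ)) =O[𝓝[>] 0] (· ^ (-b)) := by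
  induction k generalizing a b with
  | zero =>
    constructor
    · refine IsBigO.of_norm_left
        ((isLittleO_exp_neg_mul_rpow_atTop one_pos (-a)).isBigO.norm_left.congr_left fun t => ?_)
      rw [Complex.norm_real, pow_zero, one_mul, neg_one_mul]
    · refine IsBigO.of_bound 1 ?_
      filter_upwards [Ioc_mem_nhdsGT zero_lt_one] with t ht
      rw [Complex.norm_real, pow_zero, one_mul, one_mul, Real.norm_eq_abs, Real.norm_eq_abs,
        abs_of_pos (Real.exp_pos _), abs_of_nonneg (Real.rpow_nonneg ht.1.le _)]
      refine (Real.exp_le_one_iff.2 (neg_nonpos.2 ht.1.le)).trans ?_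
      exact Real.one_le_rpow_of_pos_of_le_one_of_nonpos ht.1 ht.2 (neg_nonpos.2 hb.le)
  | succ k ih =>
    constructor
    · have := isBigO_rpow_top_log_smul (lt_add_one a) (ih (a + 1) b hb).1
      refine this.congr_left fun t => ?_
      simp [pow_succ]; ring
    · have := isBigO_rpow_zero_log_smul (half_lt_self hb) (ih a (b / 2) (by positivity)).2
      refine this.congr_left fun t => ?_
      simp [pow_succ]; ring

theorem locallyIntegrableOn_log_pow_mul_exp_neg (k : ℕ) :
    LocallyIntegrableOn (fun t : ℝ => (((Real.log t) ^ k * Real.exp (-t) : ℝ) : ℂ)) (Ioi 0) := by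
  refine ContinuousOn.locallyIntegrableOn ?_ measurableSet_Ioi
  refine Complex.continuous_ofReal.comp_continuousOn ?_
  exact ((Real.continuousOn_log.mono fun t ht => (ne_of_gt ht)).pow k).mul (by fun_prop)

theorem mellin_log_pow_mul_exp_neg (k : ℕ) {z : ℂ} (hz : 0 < z.re) :
    MellinConvergent (fun t : ℝ => (((Real.log t) ^ k * Real.exp (-t) : ℝ) : ℂ)) z ∧
    HasDerivAt (mellin fun t : ℝ => (((Real.log t) ^ k * Real.exp (-t) : ℝ) : ℂ))
      (mellin (fun t : ℝ => (((Real.log t) ^ (k + 1) * Real.exp (-t) : ℝ) : ℂ)) z) z := by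
  have hO := isBigO_log_pow_mul_exp_neg k (z.re + 1) (z.re / 2) (by positivity)
  have hloc := locallyIntegrableOn_log_pow_mul_exp_neg k
  refine ⟨mellinConvergent_of_isBigO_rpow hloc hO.1 (lt_add_one _) hO.2 (half_lt_self hz), ?_⟩
  have := (mellin_hasDerivAt_of_isBigO_rpow hloc hO.1 (lt_add_one _) hO.2 (half_lt_self hz)).2
  have h : (fun t : ℝ => (((Real.log t) ^ (k + 1) * Real.exp (-t) : ℝ) : ℂ)) =
      fun t : ℝ => Real.log t • (((Real.log t) ^ k * Real.exp (-t) : ℝ) : ℂ) := by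
    funext t
    rw [Complex.real_smul]
    push_cast
    ring
  rw [h]
  exact this

theorem iteratedDeriv_Gamma_eq_mellin (k : ℕ) {z : ℂ} (hz : 0 < z.re) :
    iteratedDeriv k Complex.Gamma z =
      mellin (fun t : ℝ => (((Real.log t) ^ k * Real.exp (-t) : ℝ) : ℂ)) z := by
  induction k generalizing z with
  | zero =>
    rw [iteratedDeriv_zero, Complex.Gamma_eq_integral hz, Complex.GammaIntegral_eq_mellin]
    simp
  | succ k ih =>
    rw [iteratedDeriv_succ, ← (mellin_log_pow_mul_exp_neg k hz).2.deriv]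
    refine Filter.EventuallyEq.deriv_eq ?_
    filter_upwards [(isOpen_lt continuous_const Complex.continuous_re).mem_nhds hz] with w hw
    exact ih hw

/-- The integrand of the derivatives of the gamma function, in terms of `exp` only. -/
theorem integrableOn_and_integral_eq_iteratedDeriv_Gamma (k : ℕ) {z : ℂ} (hz : 0 < z.re) :
    IntegrableOn (fun t : ℝ => ((Real.exp (-t) / t : ℝ) : ℂ) *
      ((Real.log t : ℂ) ^ k * Complex.exp (Real.log t * z))) (Ioi 0) ∧
    ∫ t in Ioi (0 : ℝ), ((Real.exp (-t) / t : ℝ) : ℂ) *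
      ((Real.log t : ℂ) ^ k * Complex.exp (Real.log t * z)) =
      iteratedDeriv k Complex.Gamma z := by
  have hEq : EqOn (fun t : ℝ => ((Real.exp (-t) / t : ℝ) : ℂ) *
      ((Real.log t : ℂ) ^ k * Complex.exp (Real.log t * z)))
      (fun t : ℝ => (t : ℂ) ^ (z - 1) • (((Real.log t) ^ k * Real.exp (-t) : ℝ) : ℂ)) (Ioi 0) := by
    intro t ht
    have ht0 : (t : ℂ) ≠ 0 := Complex.ofReal_ne_zero.2 (ne_of_gt ht)
    simp only [smul_eq_mul]
    rw [Complex.cpow_sub _ _ ht0, Complex.cpow_one, Complex.cpow_def_of_ne_zero ht0,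
      ← Complex.ofReal_log (le_of_lt ht)]
    push_cast
    ring
  refine ⟨((mellin_log_pow_mul_exp_neg k hz).1).congr_fun hEq.symm measurableSet_Ioi, ?_⟩
  rw [iteratedDeriv_Gamma_eq_mellin k hz, setIntegral_congr_fun measurableSet_Ioi hEq]
  rfl

theorem integrableOn_and_integral_eq_deriv_Gamma {s : ℝ} (hs : 0 < s) :
    IntegrableOn (fun t : ℝ => Real.exp (-t) * Real.log t * t ^ (s - 1)) (Ioi 0) ∧
    ∫ t in Ioi (0 : ℝ), Real.exp (-t) * Real.log t * t ^ (s - 1) = deriv Real.Gamma s := by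
  have hs' : 0 < (s : ℂ).re := by simpa
  have hEq : EqOn (fun t : ℝ => ((Real.exp (-t) / t : ℝ) : ℂ) *
      ((Real.log t : ℂ) ^ 1 * Complex.exp (Real.log t * s)))
      (fun t : ℝ => ((Real.exp (-t) * Real.log t * t ^ (s - 1) : ℝ) : ℂ)) (Ioi 0) := by
    intro t ht
    have ht' : (0 : ℝ) < t := ht
    simp only
    rw [Real.rpow_sub_one ht'.ne', Real.rpow_def_of_pos ht']
    push_cast
    ring
  obtain ⟨hi, hI⟩ := integrableOn_and_integral_eq_iteratedDeriv_Gamma 1 hs'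
  have hi' := hi.congr_fun hEq measurableSet_Ioi
  rw [setIntegral_congr_fun measurableSet_Ioi hEq, integral_complex_ofReal, iteratedDeriv_one]
    at hI
  refine ⟨?_, ?_⟩
  · exact hi'.re
  -- On the real line `Real.Gamma` is by definition the real part of `Complex.Gamma`, so its
  -- derivative is the real part of the complex one.
  · have hd : HasDerivAt Complex.Gamma (deriv Complex.Gamma s) (s : ℂ) := by
      refine (Complex.differentiableAt_Gamma _ fun m h => ?_).hasDerivAt
      have := congrArg Complex.re h
      simp at this
      have hm : (0 : ℝ) ≤ m := m.cast_nonneg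
      linarith
    rw [← hI] at hd
    have := hd.real_of_complex
    rw [Complex.ofReal_re] at this
    exact this.deriv.symm

theorem integrableOn_and_integral_neg_log_mul_rpow {a : ℝ} (ha : 0 < a) :
    IntegrableOn (fun t : ℝ => -Real.log t * t ^ (a - 1)) (Ioc 0 1) ∧
    ∫ t in Ioc (0 : ℝ) 1, -Real.log t * t ^ (a - 1) = 1 / a ^ 2 := by
  -- The antiderivative from integration by parts. It extends continuously to `0` because `t^a log t
  -- → 0`, with `F 0 = 0` and `F 1 = 1 / a²`.
  set F : ℝ → ℝ := fun t => -Real.log t * t ^ a / a + t ^ a / a ^ 2 with hF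
  have hder : ∀ t ∈ Ioo (0 : ℝ) 1, HasDerivAt F (-Real.log t * t ^ (a - 1)) t := by
    intro t ht
    have ht0 : t ≠ 0 := ht.1.ne'
    have h1 := Real.hasDerivAt_log ht0
    have h2 := Real.hasDerivAt_rpow_const (x := t) (p := a) (Or.inl ht0)
    have := ((h1.neg.mul h2).div_const a).add (h2.div_const (a ^ 2))
    refine this.congr_deriv ?_
    rw [Real.rpow_sub_one ht0, Pi.neg_apply]
    field_simp
    ring
  have hcont : ContinuousOn F (Icc 0 1) := by
    intro t ht
    have hc : ContinuousAt (fun t : ℝ => t ^ a) t := Real.continuousAt_rpow_const _ _ (Or.inr ha.le)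
    rcases ht.1.eq_or_lt with rfl | ht0
    · refine ContinuousWithinAt.add ?_ (hc.div_const _).continuousWithinAt
      refine (continuousWithinAt_Ioi_iff_Ici.1 ?_).mono Icc_subset_Ici_self
      have h := ((tendsto_log_mul_rpow_nhdsGT_zero ha).neg).div_const a
      simpa [ContinuousWithinAt] using h
    · refine ContinuousAt.continuousWithinAt ?_
      exact ((((Real.continuousAt_log ht0.ne').neg).mul hc).div_const _).add (hc.div_const _)
  have hnonneg : ∀ t ∈ Ioo (0 : ℝ) 1, 0 ≤ -Real.log t * t ^ (a - 1) := fun t ht =>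
    mul_nonneg (neg_nonneg.2 (Real.log_nonpos ht.1.le ht.2.le)) (Real.rpow_nonneg ht.1.le _)
  -- The singularity at `0` needs no estimate: a nonnegative derivative of a function continuous on
  -- `[0, 1]` is integrable.
  have hint := intervalIntegral.integrableOn_deriv_of_nonneg hcont hder hnonneg
  refine ⟨hint, ?_⟩
  rw [← intervalIntegral.integral_of_le zero_le_one,
    intervalIntegral.integral_eq_sub_of_hasDerivAt_of_le zero_le_one hcont hder
      ((intervalIntegrable_iff_integrableOn_Ioc_of_le zero_le_one).2 hint)]
  simp [hF, ha.ne']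

theorem exp_neg_le_quadratic {t : ℝ} (ht : 0 ≤ t) :
    Real.exp (-t) ≤ 1 - t + (Real.cosh 1 - 1) * t ^ 2 := by
  have hcosh : (3 : ℝ) / 2 ≤ Real.cosh 1 := by
    rw [Real.cosh_eq]
    linarith [Real.exp_one_gt_d9, Real.exp_neg_one_gt_d9]
  have : Real.exp (-t) ≤ 1 - t + t ^ 2 / 2 := by
    have h := Real.quadratic_le_exp_of_nonneg ht
    have h1 : 0 < 1 + t + t ^ 2 / 2 := by positivity
    -- The product equals `(1 + t²/2)² - t² = 1 + t⁴/4`.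
    have h2 : 1 ≤ (1 - t + t ^ 2 / 2) * (1 + t + t ^ 2 / 2) := by nlinarith [sq_nonneg (t ^ 2)]
    rw [Real.exp_neg]
    exact (inv_anti₀ h1 h).trans (by rwa [inv_le_iff_one_le_mul₀ h1])
  nlinarith [sq_nonneg t]

/-- An integrable majorant of `e^{-t} (-log t) t^{a-1}` on `(0, 1]`, with its integral. -/
theorem integrableOn_and_integral_omegaBound {a : ℝ} (ha : 0 < a) :
    IntegrableOn (fun t : ℝ => (1 - t + (Real.cosh 1 - 1) * t ^ 2) *
      (-Real.log t * t ^ (a - 1))) (Ioc 0 1) ∧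
    ∫ t in Ioc (0 : ℝ) 1, (1 - t + (Real.cosh 1 - 1) * t ^ 2) *
      (-Real.log t * t ^ (a - 1)) = omegaBound a := by
  obtain ⟨i0, I0⟩ := integrableOn_and_integral_neg_log_mul_rpow ha
  obtain ⟨i1, I1⟩ := integrableOn_and_integral_neg_log_mul_rpow (a := a + 1) (by positivity)
  obtain ⟨i2, I2⟩ := integrableOn_and_integral_neg_log_mul_rpow (a := a + 2) (by positivity)
  -- Expanding the quadratic gives `1/a² - 1/(a+1)² + (cosh 1 - 1)/(a+2)²`; the first two terms
  -- combine to the fraction in `omegaBound`.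
  have hEq : EqOn (fun t : ℝ => -Real.log t * t ^ (a - 1) - -Real.log t * t ^ (a + 1 - 1)
        + (Real.cosh 1 - 1) * (-Real.log t * t ^ (a + 2 - 1)))
      (fun t : ℝ => (1 - t + (Real.cosh 1 - 1) * t ^ 2) * (-Real.log t * t ^ (a - 1)))
      (Ioc 0 1) := by
    intro t ht
    have h1 : t ^ (a + 1 - 1) = t ^ (a - 1) * t := by
      rw [← Real.rpow_add_one ht.1.ne']; congr 1; ring
    have h2 : t ^ (a + 2 - 1) = t ^ (a - 1) * t ^ 2 := by
      rw [← Real.rpow_add_natCast ht.1.ne']; congr 1; push_cast; ring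
    simp only [h1, h2]
    ring
  refine ⟨((i0.sub i1).add (i2.const_mul _)).congr_fun hEq measurableSet_Ioc, ?_⟩
  rw [← setIntegral_congr_fun measurableSet_Ioc hEq, integral_add (f := fun t : ℝ =>
      -Real.log t * t ^ (a - 1) - -Real.log t * t ^ (a + 1 - 1)) (i0.sub i1) (i2.const_mul _),
    integral_sub i0 i1, integral_const_mul, I0, I1, I2, omegaBound]
  field_simp
  ring

end GammaIntegrals

/-! ### Euler's integral for the matrix gamma function -/

section ExpJet

open MeasureTheory Set Filter Topology

open scoped Matrix.Norms.Operator Polynomial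

/-- The partial sums of the exponential series of `L * X`, as polynomials in `X`. -/
noncomputable def expPartialSum (L : ℂ) (N : ℕ) : ℂ[X] :=
  ∑ n ∈ Finset.range N, Polynomial.monomial n (L ^ n / n.factorial)

theorem derivative_expPartialSum_succ (L : ℂ) (N : ℕ) :
    Polynomial.derivative (expPartialSum L (N + 1)) = Polynomial.C L * expPartialSum L N := by
  rw [expPartialSum, expPartialSum, Finset.sum_range_succ', map_add, Finset.mul_sum, map_sum]
  simp only [Polynomial.derivative_monomial, Nat.cast_zero, mul_zero, map_zero, add_zero,
    Nat.add_sub_cancel, Polynomial.C_mul_monomial]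
  refine Finset.sum_congr rfl fun n _ => ?_
  congr 1
  rw [Nat.factorial_succ, pow_succ]
  have h1 : (n.factorial : ℂ) ≠ 0 := by exact_mod_cast n.factorial_ne_zero
  have h2 : ((n + 1 : ℕ) : ℂ) ≠ 0 := by exact_mod_cast n.succ_ne_zero
  rw [Nat.cast_mul]
  field_simp

/-- Each derivative drops one term of the partial sum and produces one factor `L`; starting from `N
+ k` terms makes this an exact identity. -/
theorem iterate_derivative_expPartialSum_add (L : ℂ) (N k : ℕ) :
    Polynomial.derivative^[k] (expPartialSum L (N + k)) =
      Polynomial.C (L ^ k) * expPartialSum L N := by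
  induction k with
  | zero => simp
  | succ k ih =>
    rw [← add_assoc, Function.iterate_succ_apply, derivative_expPartialSum_succ,
      Polynomial.iterate_derivative_C_mul, ih, ← mul_assoc, ← Polynomial.C_mul, pow_succ']

theorem tendsto_eval_iterate_derivative_expPartialSum (L z : ℂ) (k : ℕ) :
    Tendsto (fun N => (Polynomial.derivative^[k] (expPartialSum L N)).eval z) atTop
      (𝓝 (L ^ k * Complex.exp (L * z))) := by
  rw [← tendsto_add_atTop_iff_nat k]
  simp only [iterate_derivative_expPartialSum_add, Polynomial.eval_mul, Polynomial.eval_C]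
  refine Tendsto.const_mul _ ?_
  have h := (NormedSpace.expSeries_div_hasSum_exp (L * z)).tendsto_sum_nat
  rw [← Complex.exp_eq_exp_ℂ] at h
  refine h.congr fun N => ?_
  rw [expPartialSum, Polynomial.eval_finsetSum]
  refine Finset.sum_congr rfl fun n _ => ?_
  rw [Polynomial.eval_monomial, mul_pow]
  ring

variable {ι : Type*} [Fintype ι] [DecidableEq ι]

/-- The identity holds for the polynomial partial sums. It survives the limit because their jets
converge and `G`, being linear on a finite-dimensional space, is continuous. -/
theorem exp_smul_eq_of_jet {A : Matrix ι ι ℂ} {G : (JetIndex A → ℂ) →ₗ[ℂ] Matrix ι ι ℂ}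
    (hG : ∀ p : ℂ[X],
      Polynomial.aeval A p = G fun x => (Polynomial.derivative^[(x.2 : ℕ)] p).eval (x.1 : ℂ))
    (L : ℂ) :
    NormedSpace.exp (L • A) = G fun x => L ^ (x.2 : ℕ) * Complex.exp (L * x.1) := by
  have h1 : Tendsto (fun N => Polynomial.aeval A (expPartialSum L N)) atTop
      (𝓝 (NormedSpace.exp (L • A))) := by
    refine (hasSum_matrix_exp_smul L A).tendsto_sum_nat.congr fun N => ?_
    rw [expPartialSum, map_sum]
    refine Finset.sum_congr rfl fun n _ => ?_
    rw [Polynomial.aeval_monomial, Algebra.smul_def]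
  have h2 : Tendsto (fun N => Polynomial.aeval A (expPartialSum L N)) atTop
      (𝓝 (G fun x => L ^ (x.2 : ℕ) * Complex.exp (L * x.1))) := by
    simp only [hG]
    refine ((LinearMap.continuous_of_finiteDimensional G).tendsto _).comp ?_
    exact tendsto_pi_nhds.2 fun x => tendsto_eval_iterate_derivative_expPartialSum L x.1 x.2
  exact tendsto_nhds_unique h1 h2

/-- Euler's integral for the matrix gamma function. -/
theorem integrableOn_and_integral_eq_matrixGamma {A : Matrix ι ι ℂ}
    (hA : ∀ z ∈ spectrum ℂ A, 0 < z.re) (i j : ι) :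
    IntegrableOn (fun t : ℝ => ((Real.exp (-t) / t : ℝ) : ℂ) *
      NormedSpace.exp ((Real.log t : ℂ) • A) i j) (Ioi 0) ∧
    ∫ t in Ioi (0 : ℝ), ((Real.exp (-t) / t : ℝ) : ℂ) *
      NormedSpace.exp ((Real.log t : ℂ) • A) i j = matrixGamma A i j := by
  obtain ⟨G, hG, hGf⟩ := exists_linearMap_jet A
  let g : (JetIndex A → ℂ) →L[ℂ] ℂ :=
    LinearMap.toContinuousLinearMap ((Matrix.entryLinearMap ℂ ℂ i j).comp G)
  have hg : ∀ v, g v = G v i j := fun v => rfl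
  -- The jet of `z ↦ (e^{-t}/t) e^{z log t}`. Its integral over `t` is the jet of `Γ`, and the
  -- continuous linear functional `g` commutes with the integral.
  let h : ℝ → JetIndex A → ℂ := fun t x => ((Real.exp (-t) / t : ℝ) : ℂ) *
    ((Real.log t : ℂ) ^ (x.2 : ℕ) * Complex.exp (Real.log t * x.1))
  have hx := fun x : JetIndex A =>
    integrableOn_and_integral_eq_iteratedDeriv_Gamma (x.2 : ℕ) (hA _ x.mem_spectrum)
  have hint : Integrable h (volume.restrict (Ioi 0)) := Integrable.of_eval fun x => (hx x).1
  have hgh : ∀ t, g (h t) = ((Real.exp (-t) / t : ℝ) : ℂ) *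
      NormedSpace.exp ((Real.log t : ℂ) • A) i j := by
    intro t
    rw [exp_smul_eq_of_jet hG, ← hg, ← smul_eq_mul, ← map_smul]
    rfl
  simp only [← hgh]
  refine ⟨g.integrable_comp hint, ?_⟩
  rw [g.integral_comp_comm hint, matrixGamma, hGf, ← hg]
  congr 1
  funext x
  rw [← (hx x).2]
  exact eval_integral (fun x => (hx x).1) x

/-- Splitting off the scalar part keeps the exact modulus `e^{L Re z}` for real `L`, so that only
`X` has to be estimated with `|L|`. -/
theorem exp_smul_smul_one_add_apply (L z : ℂ) (X : Matrix ι ι ℂ) (i j : ι) :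
    NormedSpace.exp (L • (z • (1 : Matrix ι ι ℂ) + X)) i j =
      Complex.exp (L * z) * NormedSpace.exp (L • X) i j := by
  have h1 : L • (z • (1 : Matrix ι ι ℂ) + X) = algebraMap ℂ (Matrix ι ι ℂ) (L * z) + L • X := by
    rw [smul_add, smul_smul, Algebra.algebraMap_eq_smul_one]
  have h2 : Commute (algebraMap ℂ (Matrix ι ι ℂ) (L * z)) (L • X) := Algebra.commutes _ _
  have h3 : NormedSpace.exp (algebraMap ℂ (Matrix ι ι ℂ) (L * z)) =
      algebraMap ℂ (Matrix ι ι ℂ) (NormedSpace.exp (L * z)) :=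
    (NormedSpace.algebraMap_exp_comm (𝔸 := Matrix ι ι ℂ) (L * z)).symm
  rw [h1, Matrix.exp_add_of_commute _ _ h2, h3, ← Algebra.smul_def, Matrix.smul_apply, smul_eq_mul,
    ← Complex.exp_eq_exp_ℂ]

end ExpJet

/-! ### The perturbation bound for the matrix gamma function -/

section Perturbation

open MeasureTheory Set Filter Topology

variable {ι : Type*} [Fintype ι] [DecidableEq ι]

/-- The scalar majorant of the perturbation integrand: off `(0, 1]` it is the integrand of
`Γ'(s + n)`. -/
theorem exp_neg_div_mul_log_mul_exp_le {t s n : ℝ} (ht : 0 < t) :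
    Real.exp (-t) / t * Real.exp (Real.log t * s) *
        (|Real.log t| * Real.exp (|Real.log t| * n)) ≤
      Real.exp (-t) * Real.log t * t ^ (s + n - 1) +
        (Ioc 0 1).indicator (fun t : ℝ =>
          (1 - t + (Real.cosh 1 - 1) * t ^ 2) * (-Real.log t * t ^ (s + n - 1)) +
          (1 - t + (Real.cosh 1 - 1) * t ^ 2) * (-Real.log t * t ^ (s - n - 1))) t := by
  have hp : t ^ (s + n - 1) = Real.exp (Real.log t * s) * Real.exp (Real.log t * n) / t := by
    rw [Real.rpow_sub_one ht.ne', Real.rpow_def_of_pos ht, mul_add, Real.exp_add]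
  have hm : t ^ (s - n - 1) = Real.exp (Real.log t * s) * Real.exp (-Real.log t * n) / t := by
    rw [Real.rpow_sub_one ht.ne', Real.rpow_def_of_pos ht, ← Real.exp_add]
    congr 2
    ring
  by_cases h1 : t ≤ 1
  · have hlog := Real.log_nonpos ht.le h1
    have hmem : t ∈ Ioc (0 : ℝ) 1 := ⟨ht, h1⟩
    rw [indicator_of_mem hmem, abs_of_nonpos hlog]
    have hq := exp_neg_le_quadratic ht.le
    have e1 : 0 ≤ -Real.log t * t ^ (s + n - 1) :=
      mul_nonneg (neg_nonneg.2 hlog) (Real.rpow_nonneg ht.le _)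
    have e2 : 0 ≤ -Real.log t * t ^ (s - n - 1) :=
      mul_nonneg (neg_nonneg.2 hlog) (Real.rpow_nonneg ht.le _)
    -- `e3` absorbs the nonpositive term `e^{-t} log t · t^(s+n-1)` on the right; `e4` bounds the
    -- left side, which carries the exponent `s - n - 1` because `|log t| = -log t`.
    have e3 := mul_le_mul_of_nonneg_right hq e1
    have e4 := mul_le_mul_of_nonneg_right hq e2
    have e5 : Real.exp (-t) / t * Real.exp (Real.log t * s) *
        (-Real.log t * Real.exp (-Real.log t * n)) =
        Real.exp (-t) * (-Real.log t * t ^ (s - n - 1)) := by rw [hm]; ring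
    rw [e5]
    linarith
  · have hlog := Real.log_nonneg (not_le.1 h1).le
    rw [indicator_of_notMem (fun h => h1 h.2), abs_of_nonneg hlog, hp]
    apply le_of_eq
    ring

theorem norm_matrixGamma_sub_apply_le (p : ENNReal) [Fact (1 ≤ p)] {lam : ℂ} {M R : Matrix ι ι ℝ}
    {Q : Matrix ι ι ℂ} (hM : ∀ i j, 0 ≤ M i j) (hQ : ∀ i j, ‖Q i j‖ ≤ R i j)
    (hlam : 0 < lam.re - inducedNorm p (M + R))
    (h1 : ∀ z ∈ spectrum ℂ (lam • 1 + M.map Complex.ofReal), 0 < z.re)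
    (h2 : ∀ z ∈ spectrum ℂ (lam • 1 + M.map Complex.ofReal + Q), 0 < z.re) (i j : ι) :
    ‖matrixGamma (lam • 1 + M.map Complex.ofReal + Q) i j
        - matrixGamma (lam • 1 + M.map Complex.ofReal) i j‖ ≤ deltaBound p lam M R := by
  obtain ⟨i1, I1⟩ := integrableOn_and_integral_eq_matrixGamma h1 i j
  obtain ⟨i2, I2⟩ := integrableOn_and_integral_eq_matrixGamma h2 i j
  rw [deltaBound]
  set n := inducedNorm p (M + R)
  have hn : 0 ≤ n := inducedNorm_nonneg p _
  have hsum : 0 < lam.re + n := by linarith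
  obtain ⟨j0, J0⟩ := integrableOn_and_integral_eq_deriv_Gamma hsum
  obtain ⟨j1, J1⟩ := integrableOn_and_integral_omegaBound hsum
  obtain ⟨j2, J2⟩ := integrableOn_and_integral_omegaBound hlam
  have j3 := ((j1.add j2).integrable_indicator measurableSet_Ioc).integrableOn (s := Ioi 0)
  simp only [Pi.add_def] at j3
  have J3 : ∫ t in Ioi (0 : ℝ), (Ioc 0 1).indicator (fun t : ℝ =>
      (1 - t + (Real.cosh 1 - 1) * t ^ 2) * (-Real.log t * t ^ (lam.re + n - 1)) +
      (1 - t + (Real.cosh 1 - 1) * t ^ 2) * (-Real.log t * t ^ (lam.re - n - 1))) t =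
      omegaBound (lam.re + n) + omegaBound (lam.re - n) := by
    rw [setIntegral_indicator measurableSet_Ioc, inter_eq_self_of_subset_right Ioc_subset_Ioi_self,
      integral_add j1 j2, J1, J2]
  -- Both sides become single integrals over `(0, ∞)`, which reduces the claim to a pointwise bound
  -- on the integrands.
  rw [← I1, ← I2, ← integral_sub i2 i1, add_assoc (deriv _ _), ← J0, ← J3, ← integral_add j0 j3,
    ← integral_const_mul]
  refine norm_integral_le_of_norm_le ((j0.add j3).const_mul _) ?_
  filter_upwards [ae_restrict_mem measurableSet_Ioi] with t ht
  have ht' : 0 < t := ht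
  refine le_trans ?_ (mul_le_mul_of_nonneg_left (exp_neg_div_mul_log_mul_exp_le (s := lam.re)
    (n := n) ht') (inducedNorm_nonneg p R))
  rw [add_assoc (lam • 1), exp_smul_smul_one_add_apply, exp_smul_smul_one_add_apply, ← mul_sub, ← mul_sub,
    norm_mul, norm_mul, Complex.norm_real, Complex.norm_exp, Complex.re_ofReal_mul,
    Real.norm_of_nonneg (by positivity), ← mul_assoc]
  refine (mul_le_mul_of_nonneg_left (norm_exp_smul_sub_exp_smul_apply_le p hM hQ (Real.log t) i j)
    (by positivity)).trans (le_of_eq ?_)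
  ring

/-- The eigenvalues of `z + X` lie in the half plane `0 < Re` if `Re z` exceeds the induced norm
of an entrywise majorant of `X`. -/
theorem re_pos_of_mem_spectrum (p : ENNReal) [Fact (1 ≤ p)] {lam : ℂ} {X : Matrix ι ι ℂ}
    {B : Matrix ι ι ℝ} (h : ∀ i j, ‖X i j‖ ≤ B i j) (hlam : 0 < lam.re - inducedNorm p B) {z : ℂ}
    (hz : z ∈ spectrum ℂ (lam • 1 + X)) : 0 < z.re := by
  rw [← Algebra.algebraMap_eq_smul_one, ← spectrum.singleton_add_eq,
    Set.singleton_add, Set.mem_image] at hz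
  obtain ⟨w, hw, rfl⟩ := hz
  have h1 := norm_le_inducedNorm_of_mem_spectrum p h hw
  have h2 := (abs_le.1 (Complex.abs_re_le_norm w)).1
  rw [Complex.add_re]
  linarith

theorem gammaDefinedAt_of_re_pos {A : Matrix ι ι ℂ} (hA : ∀ z ∈ spectrum ℂ A, 0 < z.re) :
    GammaDefinedAt A := by
  intro k hk
  have := hA _ hk
  rw [Complex.neg_re, Complex.natCast_re] at this
  exact absurd (Nat.cast_nonneg (α := ℝ) k) (by linarith)

end Perturbation

/-! ### Application to nilpotent Jordan matrices -/

theorem nilpotentJordan_nonneg {s : ℕ} (d : Fin s → ℕ) (i j : Σ l : Fin s, Fin (d l)) :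
    0 ≤ nilpotentJordan d i j := by
  rw [nilpotentJordan, Matrix.blockDiagonal'_apply]
  split_ifs
  · rw [nilpotentBlock, Matrix.of_apply]
    split_ifs <;> norm_num
  · exact le_rfl

theorem corollary5p2 {s : ℕ} (d : Fin s → ℕ) (hd : ∀ l, 0 < d l) (lam : ℂ)
    (M R : Matrix (Σ l : Fin s, Fin (d l)) (Σ l : Fin s, Fin (d l)) ℝ)
    (Q : Matrix (Σ l : Fin s, Fin (d l)) (Σ l : Fin s, Fin (d l)) ℂ)
    (hM : M = nilpotentJordan d)
    (hR : ∀ i j, 0 ≤ R i j)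
    (hQ : ∀ i j, ‖Q i j‖ ≤ R i j)
    (h_one : 0 < lam.re - inducedNorm 1 (M + R))
    (h_top : 0 < lam.re - inducedNorm ⊤ (M + R)) :
    GammaDefinedAt (lam • 1 + M.map Complex.ofReal) ∧
    GammaDefinedAt (lam • 1 + M.map Complex.ofReal + Q) ∧
    matrixGamma (lam • 1 + M.map Complex.ofReal + Q) ∈
      intervalMatrix (matrixGamma (lam • 1 + M.map Complex.ofReal))
        (Matrix.of fun _ _ => min (deltaBound 1 lam M R) (deltaBound ⊤ lam M R)) := by
  have hM0 : ∀ i j, 0 ≤ M i j := fun i j => hM ▸ nilpotentJordan_nonneg d i j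
  -- The norm for `p = 1` already locates both spectra; the two values of `p` are needed separately
  -- only for the minimum of the bounds.
  have h1 : ∀ z ∈ spectrum ℂ (lam • 1 + M.map Complex.ofReal), 0 < z.re := fun z hz =>
    re_pos_of_mem_spectrum 1 (B := M + R) (fun i j => by
      simpa [abs_of_nonneg (hM0 i j)] using hR i j) h_one hz
  have h2 : ∀ z ∈ spectrum ℂ (lam • 1 + M.map Complex.ofReal + Q), 0 < z.re := fun z hz =>
    re_pos_of_mem_spectrum 1 (norm_ofReal_map_add_apply_le hM0 hQ) h_one
      (by rwa [← add_assoc])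
  exact ⟨gammaDefinedAt_of_re_pos h1, gammaDefinedAt_of_re_pos h2, fun i j =>
    le_min (norm_matrixGamma_sub_apply_le 1 hM0 hQ h_one h1 h2 i j)
      (norm_matrixGamma_sub_apply_le ⊤ hM0 hQ h_top h1 h2 i j)⟩
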